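/- Let $N \geq 2$ be an integer, let $(n_i)_{i \geq 0}$ be a sequence of pairwise distinct real numbers in $\mathbb{Z}_{\geq 0} \cup [N-2,\infty)$, and let $\epsilon_i \in \{-1,0,+1\}$ for each $i \geq 0$. For $I \subset (0,\infty)$ let $\mathbb{P}_N(I)$ denote the set of real symmetric positive semidefinite $N \times N$ matrices all of whose entries lie in $I$. A function $f : I \to \mathbb{R}$ is said to preserve positivity entrywise on $\mathbb{P}_N(I)$ if for every $A = (a_{jk}) \in \mathbb{P}_N(I)$ the matrix $(f(a_{jk}))_{j,k=1}^N$ is positive semidefinite. (1) Suppose that whenever $\epsilon_{i_0} = -1$, one has $\epsilon_i = +1$ for at least $N$ indices $i$ with $n_i < n_{i_0}$. Then for every $0 < \rho < \infty$ there exist real coefficients $(c_i)_{i \geq 0}$, with $c_i$ of sign $\epsilon_i$ for all $i$, such that the series $$f(x) = \sum_{i=0}^\infty c_i x^{n_i}$$ converges (absolutely) for every $x \in (0,\rho)$ and $f$ preserves positivity entrywise on $\mathbb{P}_N((0,\rho))$. (2) Suppose that whenever $\epsilon_{i_0} = -1$, one has $\epsilon_i = +1$ for at least $N$ indices $i$ with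 $n_i < n_{i_0}$, and also $\epsilon_i = +1$ for at least $N$ indices $i$ with $n_i > n_{i_0}$. Then there exist real coefficients $(c_i)_{i \geq 0}$, with $c_i$ of sign $\epsilon_i$ for all $i$, such that the series $f(x) = \sum_{i=0}^\infty c_i x^{n_i}$ converges (absolutely) for every $x \in (0,\infty)$ and $f$ preserves positivity entrywise on $\mathbb{P}_N((0,\infty))$. -/

import Mathlib

/-- The set of `N × N` positive semidefinite matrices all of whose entries lie in `I ⊆ ℝ`. -/
def psdMatricesIn (N : ℕ) (I : Set ℝ) : Set (Matrix (Fin N) (Fin N) ℝ) :=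
  {A | A.PosSemidef ∧ ∀ j k, A j k ∈ I}

/-- `f` preserves positivity entrywise on the positive semidefinite `N × N` matrices with entries
in `I`: applying `f` to each entry of such a matrix gives a positive semidefinite matrix.  Only the
values of `f` on `I` matter. -/
def IsEntrywisePositivityPreserver (N : ℕ) (I : Set ℝ) (f : ℝ → ℝ) : Prop :=
  ∀ A ∈ psdMatricesIn N I, (A.map f).PosSemidef

/-- `f(x) = ∑ᵢ cᵢ x ^ nᵢ` for each `x ∈ I`, the series being (unconditionally) convergent there. -/
def IsRealPowerSum (n c : ℕ → ℝ) (I : Set ℝ) (f : ℝ → ℝ) : Prop :=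
  ∀ x ∈ I, HasSum (fun i => c i * x ^ n i) (f x)

/-!
The function is built as one series in which each negative term is dominated by positive ones. For a
negative exponent `m`, choose `N` exponents below it with positive coefficients and, on `(0, ∞)`,
also `N` above it. The quadratic form of the entrywise power `A ^ m` is then at most a constant times
the sum of the quadratic forms of these positive powers, uniformly in `A`
(`exists_preserver_sum_sub`). Giving the `i`-th negative term a factor `(1/2) ^ (i + 1)` on top of
this constant makes all negative terms together at most the sum of the positive ones
(`exists_preserver_of_signs`).

For rank-one matrices the domination is a statement about interpolation: on any `N` points `u` the
function `u ^ m` is a combination of the chosen powers with coefficients bounded independently of the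
points (`exists_bounded_interpolation`). In the variable `s = log u` this is a bound for the
coefficients of an exponential sum with prescribed zeros (`exists_coeff_bound`), proved by induction:
dividing by one exponential and differentiating removes a term, and Rolle's theorem supplies the
zeros of the derivative. What is preserved is that there are as many zeros in `(-∞, r]` as exponents
below `m`, and as many in `(r, ∞)` as exponents above `m`. The zero of the derivative between the two
groups may fall on either side of `r`; the sign of the logarithmic derivative at `r` decides whether
to divide by the lowest or by the highest exponential so that the count stays right
(`exists_zeros_of_erase`). For bounded entries `r` is taken so large that no point lies beyond it,
and no exponents above `m` are needed.

The passage to all ranks is the argument of FitzGerald and Horn: a function preserves positivity in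
size `k + 1` if it does so on rank-one matrices and its derivative preserves positivity in size `k`
(`isEntrywisePositivityPreserver_succ`). Differentiation lowers the exponents by one, which is why
they have to be nonnegative integers or at least `N - 2`.
-/

/-! ### Zeros of derivatives -/

/-- Rolle's theorem for a finite set of zeros, remembering that the new zeros lie strictly between
old ones. -/
lemma exists_finset_deriv_zeros {g g' : ℝ → ℝ} (hg : ∀ x, HasDerivAt g (g' x) x) (S : Finset ℝ)
    (hS : ∀ s ∈ S, g s = 0) :
    ∃ S' : Finset ℝ, S'.card = S.card - 1 ∧ (∀ s ∈ S', g' s = 0) ∧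
      ∀ s ∈ S', (∃ x ∈ S, x < s) ∧ ∃ x ∈ S, s < x := by
  induction S using Finset.induction_on_max with
  | empty => exact ⟨∅, by simp⟩
  | insert b S hb ih =>
    obtain ⟨S', hcard, hzero, hbtw⟩ := ih fun s hs => hS s (Finset.mem_insert_of_mem hs)
    have hbS : b ∉ S := fun h => lt_irrefl _ (hb b h)
    rcases S.eq_empty_or_nonempty with rfl | hne
    · exact ⟨∅, by simp⟩
    have hM := S.max'_mem hne
    obtain ⟨z, hz, hgz⟩ := exists_hasDerivAt_eq_zero (f := g) (f' := g') (hb _ hM)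
      (fun x _ => (hg x).continuousAt.continuousWithinAt)
      (by rw [hS _ (Finset.mem_insert_of_mem hM), hS _ (Finset.mem_insert_self _ _)])
      (fun x _ => hg x)
    have hzS' : z ∉ S' := fun h => by
      obtain ⟨x, hx, hzx⟩ := (hbtw z h).2
      exact absurd (S.le_max' x hx) (not_le.2 (hz.1.trans hzx))
    refine ⟨insert z S', ?_, ?_, ?_⟩
    · rw [Finset.card_insert_of_notMem hzS', Finset.card_insert_of_notMem hbS, hcard]
      have := hne.card_pos
      omega
    · intro s hs
      rcases Finset.mem_insert.1 hs with rfl | hs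
      exacts [hgz, hzero s hs]
    · intro s hs
      rcases Finset.mem_insert.1 hs with rfl | hs
      · exact ⟨⟨_, Finset.mem_insert_of_mem hM, hz.1⟩, b, Finset.mem_insert_self _ _, hz.2⟩
      · obtain ⟨⟨x, hx, h1⟩, y, hy, h2⟩ := hbtw s hs
        exact ⟨⟨x, Finset.mem_insert_of_mem hx, h1⟩, y, Finset.mem_insert_of_mem hy, h2⟩

lemma exists_zero_of_mul_nonpos {f : ℝ → ℝ} (hf : Continuous f) {a b : ℝ} (hab : a ≤ b)
    (h : f a * f b ≤ 0) : ∃ z ∈ Set.Icc a b, f z = 0 := by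
  rcases mul_nonpos_iff.1 h with ⟨h1, h2⟩ | ⟨h1, h2⟩
  · exact intermediate_value_Icc' hab hf.continuousOn ⟨h2, h1⟩
  · exact intermediate_value_Icc hab hf.continuousOn ⟨h1, h2⟩

/-- If `g` vanishes at `a < r` and `|g|` does not increase at `r`, then `g` has a critical point in
`(a, r]`. -/
lemma exists_deriv_zero_left {g g' : ℝ → ℝ} (hg : ∀ x, HasDerivAt g (g' x) x) (hg' : Continuous g')
    {a r : ℝ} (har : a < r) (ha : g a = 0) (h : g' r * g r ≤ 0) :
    ∃ z, a < z ∧ z ≤ r ∧ g' z = 0 := by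
  obtain ⟨ξ, hξ, hs⟩ := exists_hasDerivAt_eq_slope g g' har
    (fun x _ => (hg x).continuousAt.continuousWithinAt) (fun x _ => hg x)
  have hpos : 0 < r - a := sub_pos.2 har
  have : g r = g' ξ * (r - a) := by rw [hs, ha]; field_simp; ring
  obtain ⟨z, hz, hz0⟩ := exists_zero_of_mul_nonpos hg' hξ.2.le (by
    rw [this] at h
    by_contra hc
    push Not at hc
    nlinarith [mul_pos hc hpos])
  exact ⟨z, hξ.1.trans_le hz.1, hz.2, hz0⟩

/-- If `g` vanishes at `b > r` and `|g|` increases at `r`, then `g` has a critical point in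
`(r, b)`. -/
lemma exists_deriv_zero_right {g g' : ℝ → ℝ} (hg : ∀ x, HasDerivAt g (g' x) x)
    (hg' : Continuous g') {b r : ℝ} (hrb : r < b) (hb : g b = 0) (h : 0 < g' r * g r) :
    ∃ z, r < z ∧ z < b ∧ g' z = 0 := by
  obtain ⟨ξ, hξ, hs⟩ := exists_hasDerivAt_eq_slope g g' hrb
    (fun x _ => (hg x).continuousAt.continuousWithinAt) (fun x _ => hg x)
  have hpos : 0 < b - r := sub_pos.2 hrb
  have : g r = -(g' ξ * (b - r)) := by rw [hs, hb]; field_simp; ring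
  obtain ⟨z, hz, hz0⟩ := exists_zero_of_mul_nonpos hg' hξ.1.le (by
    rw [this] at h
    by_contra hc
    push Not at hc
    nlinarith [mul_pos hc hpos])
  refine ⟨z, lt_of_le_of_ne hz.1 ?_, hz.2.trans_lt hξ.2, hz0⟩
  rintro rfl
  simp [hz0] at h

/-! ### Exponential sums with prescribed zeros -/

/-- The exponential sum `c * exp (m * s) + ∑ e ∈ E, a e * exp (α e * s)`, in which the exponent `m`
is distinguished. -/
noncomputable def expSum {ι : Type*} (α : ι → ℝ) (m : ℝ) (E : Finset ι) (c : ℝ) (a : ι → ℝ)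
    (s : ℝ) : ℝ :=
  c * Real.exp (m * s) + ∑ e ∈ E, a e * Real.exp (α e * s)

lemma continuous_expSum {ι : Type*} (α : ι → ℝ) (m : ℝ) (E : Finset ι) (c : ℝ) (a : ι → ℝ) :
    Continuous (expSum α m E c a) := by
  unfold expSum
  fun_prop

/-- Dividing an exponential sum by one of its exponentials and differentiating removes that
exponential and rescales the other coefficients. -/
lemma hasDerivAt_exp_mul_expSum {ι : Type*} [DecidableEq ι] (α : ι → ℝ) (m : ℝ)
    (E : Finset ι) (c : ℝ) (a : ι → ℝ) (e₀ : ι) (s : ℝ) :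
    HasDerivAt (fun s => Real.exp (-α e₀ * s) * expSum α m E c a s)
      (Real.exp (-α e₀ * s) * expSum α m (E.erase e₀) (c * (m - α e₀))
        (fun e => a e * (α e - α e₀)) s) s := by
  have hexp : ∀ β : ℝ, HasDerivAt (fun s => Real.exp (β * s)) (Real.exp (β * s) * β) s := fun β => by
    simpa using ((hasDerivAt_id s).const_mul β).exp
  have hsum := ((hexp m).const_mul c).add
    (HasDerivAt.fun_sum (u := E) fun e _ => (hexp (α e)).const_mul (a e))
  refine ((hexp (-α e₀)).mul hsum).congr_deriv ?_
  rw [show expSum α m (E.erase e₀) (c * (m - α e₀)) (fun e => a e * (α e - α e₀)) s =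
    expSum α m E (c * (m - α e₀)) (fun e => a e * (α e - α e₀)) s by
      unfold expSum
      rw [Finset.sum_erase E (by simp)]]
  simp only [expSum, Pi.add_apply]
  have : ∑ e ∈ E, a e * (α e - α e₀) * Real.exp (α e * s) =
      ∑ e ∈ E, a e * (Real.exp (α e * s) * α e) - α e₀ * ∑ e ∈ E, a e * Real.exp (α e * s) := by
    rw [Finset.mul_sum, ← Finset.sum_sub_distrib]
    exact Finset.sum_congr rfl fun e _ => by ring
  rw [this]
  ring

/-- Bounds for all coefficients but one give a bound for the last one, provided the exponential sum
vanishes at a point `s` where the quotients by the exponential in question are controlled. -/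
lemma exists_coeff_bound_of_erase {ι : Type*} [DecidableEq ι] (α : ι → ℝ)
    (hα : Function.Injective α) (m r : ℝ) (E : Finset ι) (e₀ : ι) (C : ℝ) (hC : 0 ≤ C) :
    ∃ K, 0 ≤ K ∧ ∀ (c : ℝ) (a : ι → ℝ) (s : ℝ),
      (∀ e ∈ E.erase e₀, |a e * (α e - α e₀)| ≤ C * |c * (m - α e₀)|) →
      expSum α m E c a s = 0 → (∀ e ∈ E, (α e - α e₀) * s ≤ (α e - α e₀) * r) →
      (m - α e₀) * s ≤ (m - α e₀) * r → ∀ e ∈ E, |a e| ≤ K * |c| := by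
  set B : ι → ℝ := fun e => C * |m - α e₀| / |α e - α e₀| with hB
  have hB0 : ∀ e, 0 ≤ B e := fun e => by positivity
  have hterm : ∀ e, 0 ≤ B e * (1 + Real.exp ((α e - α e₀) * r)) := fun e =>
    mul_nonneg (hB0 e) (by positivity)
  have hsum0 := Finset.sum_nonneg fun e (_ : e ∈ E.erase e₀) => hterm e
  refine ⟨Real.exp ((m - α e₀) * r) + ∑ e ∈ E.erase e₀, B e * (1 + Real.exp ((α e - α e₀) * r)),
    by positivity, fun c a s ha hs hE hm => ?_⟩
  have hne : ∀ e ∈ E.erase e₀, |a e| ≤ B e * |c| := fun e he => by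
    have hpos : 0 < |α e - α e₀| :=
      abs_pos.2 (sub_ne_zero.2 fun h => (Finset.mem_erase.1 he).1 (hα h))
    have := ha e he
    rw [abs_mul, abs_mul] at this
    rw [hB]
    simp only
    rw [div_mul_eq_mul_div, le_div_iff₀ hpos]
    linarith
  intro e he
  by_cases h0 : e = e₀
  · subst h0
    have key : a e = -(c * Real.exp ((m - α e) * s) +
        ∑ x ∈ E.erase e, a x * Real.exp ((α x - α e) * s)) := by
      have h1 : Real.exp (-α e * s) * expSum α m E c a s = c * Real.exp ((m - α e) * s) +
          ∑ x ∈ E, a x * Real.exp ((α x - α e) * s) := by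
        unfold expSum
        rw [mul_add, Finset.mul_sum]
        congr 1
        · rw [mul_left_comm, ← Real.exp_add]; ring_nf
        · refine Finset.sum_congr rfl fun x _ => ?_
          rw [mul_left_comm, ← Real.exp_add]; ring_nf
      rw [hs, mul_zero, ← Finset.add_sum_erase E _ he] at h1
      simp only [sub_self, zero_mul, Real.exp_zero, mul_one] at h1
      linarith
    rw [key, abs_neg, add_mul]
    refine (abs_add_le _ _).trans (add_le_add ?_ ?_)
    · rw [abs_mul, Real.abs_exp, mul_comm]
      exact mul_le_mul_of_nonneg_right (Real.exp_le_exp.2 hm) (abs_nonneg _)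
    · rw [Finset.sum_mul]
      refine (Finset.abs_sum_le_sum_abs _ _).trans (Finset.sum_le_sum fun x hx => ?_)
      rw [abs_mul, Real.abs_exp]
      have h2 := Real.exp_le_exp.2 (hE x (Finset.mem_of_mem_erase hx))
      calc |a x| * Real.exp ((α x - α e) * s)
          ≤ (B x * |c|) * Real.exp ((α x - α e) * r) := by
            gcongr
            exact hne x hx
        _ ≤ B x * (1 + Real.exp ((α x - α e) * r)) * |c| := by
            nlinarith [mul_nonneg (hB0 x) (abs_nonneg c)]
  · have he' := Finset.mem_erase.2 ⟨h0, he⟩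
    refine (hne e he').trans (mul_le_mul_of_nonneg_right ?_ (abs_nonneg _))
    have h1 := Finset.single_le_sum (f := fun e => B e * (1 + Real.exp ((α e - α e₀) * r)))
      (fun x _ => hterm x) he'
    have h2 := mul_nonneg (hB0 e) (Real.exp_pos ((α e - α e₀) * r)).le
    have h3 := Real.exp_pos ((m - α e₀) * r)
    nlinarith

/-- One step of the induction for `exists_coeff_bound`: if an exponential sum has as many zeros in
`(-∞, r]` as exponents below `m`, and as many in `(r, ∞)` as exponents above `m`, then dividing by
the exponential of lowest exponent `α p` or by that of highest exponent `α q`, and differentiating,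
one obtains an exponential sum with the same property. -/
lemma exists_zeros_of_erase {ι : Type*} [DecidableEq ι] (α : ι → ℝ) (m r : ℝ) (E : Finset ι)
    (hm : ∀ e ∈ E, α e ≠ m) {p q : ι} (hp : p ∈ E) (hq : q ∈ E) (hpmin : ∀ e ∈ E, α p ≤ α e)
    (hqmax : ∀ e ∈ E, α e ≤ α q) (c : ℝ) (a : ι → ℝ) (S T : Finset ℝ)
    (hS : ∀ s ∈ S, s ≤ r) (hT : ∀ s ∈ T, r < s)
    (hScard : S.card = (E.filter (α · < m)).card) (hTcard : T.card = (E.filter (m < α ·)).card)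
    (hS0 : ∀ s ∈ S, expSum α m E c a s = 0) (hT0 : ∀ s ∈ T, expSum α m E c a s = 0) :
    ∃ e₀, ((e₀ = p ∧ α p < m ∧ S.Nonempty) ∨ (e₀ = q ∧ m < α q ∧ T.Nonempty)) ∧
      ∃ S' T' : Finset ℝ, (∀ s ∈ S', s ≤ r) ∧ (∀ s ∈ T', r < s) ∧
        S'.card = ((E.erase e₀).filter (α · < m)).card ∧
        T'.card = ((E.erase e₀).filter (m < α ·)).card ∧
        (∀ s ∈ S', expSum α m (E.erase e₀) (c * (m - α e₀)) (fun e => a e * (α e - α e₀)) s = 0) ∧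
        ∀ s ∈ T', expSum α m (E.erase e₀) (c * (m - α e₀)) (fun e => a e * (α e - α e₀)) s = 0 := by
  have hcardlt : α p < m → ((E.erase p).filter (α · < m)).card = S.card - 1 ∧
      ((E.erase p).filter (m < α ·)).card = T.card := fun h => by
    rw [hScard, hTcard, Finset.filter_erase, Finset.filter_erase,
      Finset.card_erase_of_mem (by simp [hp, h]), Finset.erase_eq_of_notMem (by simp [h.le])]
    simp
  have hcardgt : m < α q → ((E.erase q).filter (α · < m)).card = S.card ∧
      ((E.erase q).filter (m < α ·)).card = T.card - 1 := fun h => by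
    rw [hScard, hTcard, Finset.filter_erase, Finset.filter_erase,
      Finset.erase_eq_of_notMem (by simp [h.le]), Finset.card_erase_of_mem (by simp [hq, h])]
    simp
  have hlow : S.Nonempty → α p < m := fun h => by
    have := h.card_pos
    rw [hScard, Finset.card_pos] at this
    obtain ⟨e, he⟩ := this
    rw [Finset.mem_filter] at he
    exact (hpmin e he.1).trans_lt he.2
  have hhigh : T.Nonempty → m < α q := fun h => by
    have := h.card_pos
    rw [hTcard, Finset.card_pos] at this
    obtain ⟨e, he⟩ := this
    rw [Finset.mem_filter] at he
    exact he.2.trans_le (hqmax e he.1)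
  -- `g e₀` is the exponential sum divided by `exp (α e₀ * s)`, and `g' e₀` its derivative
  set h : ι → ℝ → ℝ := fun e₀ =>
    expSum α m (E.erase e₀) (c * (m - α e₀)) (fun e => a e * (α e - α e₀)) with hh
  set g : ι → ℝ → ℝ := fun e₀ s => Real.exp (-α e₀ * s) * expSum α m E c a s with hgdef
  set g' : ι → ℝ → ℝ := fun e₀ s => Real.exp (-α e₀ * s) * h e₀ s with hg'def
  have hg : ∀ e₀ s, HasDerivAt (g e₀) (g' e₀ s) s := fun e₀ s =>
    hasDerivAt_exp_mul_expSum α m E c a e₀ s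
  have hg'c : ∀ e₀, Continuous (g' e₀) := fun e₀ =>
    (by fun_prop : Continuous fun s => Real.exp (-α e₀ * s)).mul (continuous_expSum _ _ _ _ _)
  have hg0 : ∀ e₀ s, expSum α m E c a s = 0 → g e₀ s = 0 := fun e₀ s hs => by simp [hgdef, hs]
  have hh0 : ∀ e₀ s, g' e₀ s = 0 → h e₀ s = 0 := fun e₀ s hs =>
    (mul_eq_zero.1 hs).resolve_left (Real.exp_ne_zero _)
  have rolleS := fun e₀ => exists_finset_deriv_zeros (hg e₀) S fun s hs => hg0 e₀ s (hS0 s hs)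
  have rolleT := fun e₀ => exists_finset_deriv_zeros (hg e₀) T fun s hs => hg0 e₀ s (hT0 s hs)
  -- dividing by the lowest exponential works if there is a new zero to the right of `r`, dividing
  -- by the highest one if there is a new zero in `(-∞, r]`
  suffices (S.Nonempty ∧ (T.Nonempty → ∃ z, r < z ∧ (∀ x ∈ T, z < x) ∧ g' p z = 0)) ∨
      (T.Nonempty ∧ (S.Nonempty → ∃ z, z ≤ r ∧ (∀ x ∈ S, x < z) ∧ g' q z = 0)) by
    rcases this with ⟨hne, hz⟩ | ⟨hne, hz⟩
    · obtain ⟨S', hS'c, hS'0, hS'b⟩ := rolleS p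
      have hS'r : ∀ s ∈ S', s ≤ r := fun s hs => by
        obtain ⟨x, hx, h1⟩ := (hS'b s hs).2
        exact h1.le.trans (hS x hx)
      obtain ⟨hc1, hc2⟩ := hcardlt (hlow hne)
      obtain ⟨T', hT'r, hT'c, hT'0⟩ : ∃ T' : Finset ℝ, (∀ s ∈ T', r < s) ∧ T'.card = T.card ∧
          ∀ s ∈ T', g' p s = 0 := by
        rcases T.eq_empty_or_nonempty with rfl | hTne
        · exact ⟨∅, by simp⟩
        obtain ⟨z, hrz, hzT, hgz⟩ := hz hTne
        obtain ⟨T', hT'c, hT'0, hT'b⟩ := rolleT p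
        have hzT' : z ∉ T' := fun hmem => by
          obtain ⟨x, hx, h1⟩ := (hT'b z hmem).1
          exact lt_asymm h1 (hzT x hx)
        refine ⟨insert z T', fun s hs => ?_, ?_, fun s hs => ?_⟩
        · rcases Finset.mem_insert.1 hs with rfl | hs
          · exact hrz
          · obtain ⟨x, hx, h1⟩ := (hT'b s hs).1
            exact (hT x hx).trans h1
        · have := hTne.card_pos
          rw [Finset.card_insert_of_notMem hzT', hT'c]
          omega
        · rcases Finset.mem_insert.1 hs with rfl | hs
          exacts [hgz, hT'0 s hs]
      exact ⟨p, Or.inl ⟨rfl, hlow hne, hne⟩, S', T', hS'r, hT'r, by rw [hS'c, hc1], by rw [hT'c, hc2],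
        fun s hs => hh0 p s (hS'0 s hs), fun s hs => hh0 p s (hT'0 s hs)⟩
    · obtain ⟨T', hT'c, hT'0, hT'b⟩ := rolleT q
      have hT'r : ∀ s ∈ T', r < s := fun s hs => by
        obtain ⟨x, hx, h1⟩ := (hT'b s hs).1
        exact (hT x hx).trans h1
      obtain ⟨hc1, hc2⟩ := hcardgt (hhigh hne)
      obtain ⟨S', hS'r, hS'c, hS'0⟩ : ∃ S' : Finset ℝ, (∀ s ∈ S', s ≤ r) ∧ S'.card = S.card ∧
          ∀ s ∈ S', g' q s = 0 := by
        rcases S.eq_empty_or_nonempty with rfl | hSne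
        · exact ⟨∅, by simp⟩
        obtain ⟨z, hrz, hzS, hgz⟩ := hz hSne
        obtain ⟨S', hS'c, hS'0, hS'b⟩ := rolleS q
        have hzS' : z ∉ S' := fun hmem => by
          obtain ⟨x, hx, h1⟩ := (hS'b z hmem).2
          exact lt_asymm h1 (hzS x hx)
        refine ⟨insert z S', fun s hs => ?_, ?_, fun s hs => ?_⟩
        · rcases Finset.mem_insert.1 hs with rfl | hs
          · exact hrz
          · obtain ⟨x, hx, h1⟩ := (hS'b s hs).2
            exact h1.le.trans (hS x hx)
        · have := hSne.card_pos
          rw [Finset.card_insert_of_notMem hzS', hS'c]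
          omega
        · rcases Finset.mem_insert.1 hs with rfl | hs
          exacts [hgz, hS'0 s hs]
      exact ⟨q, Or.inr ⟨rfl, hhigh hne, hne⟩, S', T', hS'r, hT'r, by rw [hS'c, hc1], by rw [hT'c, hc2],
        fun s hs => hh0 q s (hS'0 s hs), fun s hs => hh0 q s (hT'0 s hs)⟩
  rcases S.eq_empty_or_nonempty with hSe | hSne
  · refine Or.inr ⟨?_, by simp [hSe]⟩
    rw [hSe, Finset.card_empty, eq_comm, Finset.card_eq_zero] at hScard
    have hmq : m < α q := by
      rcases lt_or_gt_of_ne (hm q hq) with h1 | h1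
      · exact absurd h1 (Finset.filter_eq_empty_iff.1 hScard hq)
      · exact h1
    rw [← Finset.card_pos, hTcard, Finset.card_pos]
    exact ⟨q, Finset.mem_filter.2 ⟨hq, hmq⟩⟩
  rcases T.eq_empty_or_nonempty with hTe | hTne
  · exact Or.inl ⟨hSne, by simp [hTe]⟩
  have hs₀ := S.max'_mem hSne
  have ht₀ := T.min'_mem hTne
  set s₀ := S.max' hSne
  set t₀ := T.min' hTne
  have hrt : r < t₀ := hT _ ht₀
  have hTlt : ∀ z, z < t₀ → ∀ x ∈ T, z < x := fun z hz x hx => hz.trans_le (T.min'_le x hx)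
  have hSlt : ∀ z, s₀ < z → ∀ x ∈ S, x < z := fun z hz x hx => (S.le_max' x hx).trans_lt hz
  rcases (hS _ hs₀).eq_or_lt with hsr | hsr
  · refine Or.inl ⟨hSne, fun _ => ?_⟩
    obtain ⟨z, hz, hz0⟩ := exists_hasDerivAt_eq_zero (f := g p) (f' := g' p)
      (hsr.trans_lt hrt) (fun x _ => (hg p x).continuousAt.continuousWithinAt)
      (by rw [hg0 p _ (hS0 _ hs₀), hg0 p _ (hT0 _ ht₀)]) (fun x _ => hg p x)
    exact ⟨z, hsr ▸ hz.1, hTlt z hz.2, hz0⟩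
  -- the sign at `r` of the logarithmic derivatives decides which of the two divisions to use
  by_cases hsign : 0 < g' p r * g p r
  · refine Or.inl ⟨hSne, fun _ => ?_⟩
    obtain ⟨z, h1, h2, h3⟩ := exists_deriv_zero_right (hg p) (hg'c p) hrt (hg0 p _ (hT0 _ ht₀)) hsign
    exact ⟨z, h1, hTlt z h2, h3⟩
  · refine Or.inr ⟨hTne, fun _ => ?_⟩
    have hsign' : g' q r * g q r ≤ 0 := by
      have hpq : α p ≤ α q := hpmin q hq
      have hrel : h q r = h p r + (α p - α q) * expSum α m E c a r := by
        simp only [hh]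
        unfold expSum
        rw [Finset.sum_erase E (by simp), Finset.sum_erase E (by simp), mul_add, Finset.mul_sum,
          add_add_add_comm, ← Finset.sum_add_distrib]
        congr 1
        · ring
        · exact Finset.sum_congr rfl fun e _ => by ring
      have hp' : h p r * expSum α m E c a r ≤ 0 := by
        by_contra hcon
        push Not at hcon
        refine hsign ?_
        have := mul_pos (mul_pos (Real.exp_pos (-α p * r)) (Real.exp_pos (-α p * r))) hcon
        simp only [hgdef, hg'def]
        linarith
      have hq' : h q r * expSum α m E c a r ≤ 0 := by
        rw [hrel]
        nlinarith [mul_nonneg (sub_nonneg.2 hpq) (mul_self_nonneg (expSum α m E c a r))]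
      have := mul_nonpos_of_nonneg_of_nonpos
        (mul_pos (Real.exp_pos (-α q * r)) (Real.exp_pos (-α q * r))).le hq'
      simp only [hgdef, hg'def]
      linarith
    obtain ⟨z, h1, h2, h3⟩ := exists_deriv_zero_left (hg q) (hg'c q) hsr (hg0 q _ (hS0 _ hs₀)) hsign'
    exact ⟨z, h2, hSlt z h1, h3⟩

/-- If an exponential sum has as many zeros in `(-∞, r]` as exponents below `m`, and as many in
`(r, ∞)` as exponents above `m`, then its coefficients are bounded in terms of the coefficient of
`exp (m * s)`, uniformly in the position of the zeros. -/
theorem exists_coeff_bound {ι : Type*} [DecidableEq ι] (α : ι → ℝ) (hα : Function.Injective α)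
    (m r : ℝ) (E : Finset ι) (hm : ∀ e ∈ E, α e ≠ m) :
    ∃ C, 0 ≤ C ∧ ∀ (c : ℝ) (a : ι → ℝ) (S T : Finset ℝ), (∀ s ∈ S, s ≤ r) → (∀ s ∈ T, r < s) →
      S.card = (E.filter (α · < m)).card → T.card = (E.filter (m < α ·)).card →
      (∀ s ∈ S, expSum α m E c a s = 0) → (∀ s ∈ T, expSum α m E c a s = 0) →
      ∀ e ∈ E, |a e| ≤ C * |c| := by
  induction hn : E.card generalizing E with
  | zero =>
    rw [Finset.card_eq_zero] at hn
    exact ⟨0, le_rfl, by simp [hn]⟩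
  | succ n ih =>
    have hE : E.Nonempty := Finset.card_pos.1 (by omega)
    obtain ⟨p, hp, hpmin⟩ := E.exists_min_image α hE
    obtain ⟨q, hq, hqmax⟩ := E.exists_max_image α hE
    have hrec : ∀ e₀ ∈ E, _ := fun e₀ he₀ => ih (E.erase e₀)
      (fun e he => hm e (Finset.mem_of_mem_erase he)) (by rw [Finset.card_erase_of_mem he₀, hn]; rfl)
    obtain ⟨Cp, hCp, hbp⟩ := hrec p hp
    obtain ⟨Cq, hCq, hbq⟩ := hrec q hq
    obtain ⟨Kp, hKp, hkp⟩ := exists_coeff_bound_of_erase α hα m r E p Cp hCp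
    obtain ⟨Kq, hKq, hkq⟩ := exists_coeff_bound_of_erase α hα m r E q Cq hCq
    refine ⟨max Kp Kq, le_max_of_le_left hKp, fun c a S T hS hT hSc hTc hS0 hT0 e he => ?_⟩
    obtain ⟨e₀, he₀, S', T', hS', hT', hS'c, hT'c, hS'0, hT'0⟩ :=
      exists_zeros_of_erase α m r E hm hp hq hpmin hqmax c a S T hS hT hSc hTc hS0 hT0
    rcases he₀ with ⟨rfl, hlt, s, hs⟩ | ⟨rfl, hlt, s, hs⟩
    · have hsr := hS s hs
      refine (hkp c a s (hbp _ _ S' T' hS' hT' hS'c hT'c hS'0 hT'0) (hS0 s hs)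
        (fun x hx => ?_) ?_ e he).trans
        (mul_le_mul_of_nonneg_right (le_max_left _ _) (abs_nonneg _))
      · exact mul_le_mul_of_nonneg_left hsr (sub_nonneg.2 (hpmin x hx))
      · exact mul_le_mul_of_nonneg_left hsr (sub_nonneg.2 hlt.le)
    · have hsr := (hT s hs).le
      refine (hkq c a s (hbq _ _ S' T' hS' hT' hS'c hT'c hS'0 hT'0) (hT0 s hs)
        (fun x hx => ?_) ?_ e he).trans
        (mul_le_mul_of_nonneg_right (le_max_right _ _) (abs_nonneg _))
      · exact mul_le_mul_of_nonpos_left hsr (sub_nonpos.2 (hqmax x hx))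
      · exact mul_le_mul_of_nonpos_left hsr (sub_nonpos.2 hlt.le)

/-! ### Bounded interpolation and the rank-one inequality -/

/-- On a set of points with as many elements in `(-∞, r]` as there are exponents below `m`, and as
many in `(r, ∞)` as there are exponents above `m`, the function `exp (m * s)` is interpolated by a
combination of the exponentials `exp (α e * s)` whose coefficients are bounded independently of the
points. -/
theorem exists_bounded_interpolation {ι : Type*} [DecidableEq ι] (α : ι → ℝ)
    (hα : Function.Injective α) (m r : ℝ) (E : Finset ι) (hm : ∀ e ∈ E, α e ≠ m) :
    ∃ C, 0 ≤ C ∧ ∀ S T : Finset ℝ, (∀ s ∈ S, s ≤ r) → (∀ s ∈ T, r < s) →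
      S.card = (E.filter (α · < m)).card → T.card = (E.filter (m < α ·)).card →
      ∃ a : ι → ℝ, (∀ e ∈ E, |a e| ≤ C) ∧
        ∀ s ∈ S ∪ T, Real.exp (m * s) = ∑ e ∈ E, a e * Real.exp (α e * s) := by
  obtain ⟨C, hC, hbound⟩ := exists_coeff_bound α hα m r E hm
  refine ⟨C, hC, fun S T hS hT hSc hTc => ?_⟩
  have hdisj : Disjoint S T := Finset.disjoint_left.2 fun s h1 h2 =>
    absurd (hS s h1) (not_le.2 (hT s h2))
  have hcard : (S ∪ T).card = E.card := by
    rw [Finset.card_union_of_disjoint hdisj, hSc, hTc,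
      ← Finset.card_filter_add_card_filter_not (s := E) (α · < m)]
    congr 2
    refine Finset.filter_congr fun e he => ?_
    rw [not_lt]
    exact ⟨le_of_lt, fun h => lt_of_le_of_ne h (hm e he).symm⟩
  -- extension of a coefficient vector by zero outside `E`
  let ext : (E → ℝ) → ι → ℝ := fun b e => if h : e ∈ E then b ⟨e, h⟩ else 0
  have hext : ∀ (b : E → ℝ) (s : ℝ), ∑ e ∈ E, ext b e * Real.exp (α e * s) =
      ∑ e : E, b e * Real.exp (α e * s) := fun b s => by
    rw [← Finset.sum_coe_sort E]
    exact Finset.sum_congr rfl fun e _ => by simp [ext]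
  let V : (E → ℝ) →ₗ[ℝ] ((S ∪ T : Finset ℝ) → ℝ) :=
    { toFun := fun b s => ∑ e : E, b e * Real.exp (α e * s)
      map_add' := fun b b' => by
        ext s
        simp [add_mul, Finset.sum_add_distrib]
      map_smul' := fun k b => by
        ext s
        simp [Finset.mul_sum, mul_assoc] }
  have hinj : Function.Injective V := by
    rw [injective_iff_map_eq_zero]
    intro b hb
    have hz : ∀ s ∈ S ∪ T, expSum α m E 0 (ext b) s = 0 := fun s hs => by
      have := congrFun hb ⟨s, hs⟩
      simp only [expSum, zero_mul, zero_add, hext]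
      exact this
    ext e
    have := hbound 0 (ext b) S T hS hT hSc hTc (fun s hs => hz s (Finset.mem_union_left _ hs))
      (fun s hs => hz s (Finset.mem_union_right _ hs)) e e.2
    simpa [ext] using this
  have hsurj : Function.Surjective V :=
    (LinearMap.injective_iff_surjective_of_finrank_eq_finrank (by simp [hcard])).1 hinj
  obtain ⟨b, hb⟩ := hsurj fun s => Real.exp (m * s)
  have heq : ∀ s ∈ S ∪ T, Real.exp (m * s) = ∑ e ∈ E, ext b e * Real.exp (α e * s) := fun s hs => by
    rw [hext]
    exact (congrFun hb ⟨s, hs⟩).symm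
  have hz : ∀ s ∈ S ∪ T, expSum α m E (-1) (ext b) s = 0 := fun s hs => by
    simp only [expSum]
    rw [← heq s hs]
    ring
  refine ⟨ext b, fun e he => ?_, heq⟩
  simpa using hbound (-1) (ext b) S T hS hT hSc hTc
    (fun s hs => hz s (Finset.mem_union_left _ hs))
    (fun s hs => hz s (Finset.mem_union_right _ hs)) e he

lemma exists_superset_card_eq_of_infinite {s : Set ℝ} (hs : s.Infinite) (F : Finset ℝ)
    (hF : ∀ x ∈ F, x ∈ s) (k : ℕ) (hk : F.card ≤ k) :
    ∃ G : Finset ℝ, F ⊆ G ∧ (∀ x ∈ G, x ∈ s) ∧ G.card = k := by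
  obtain ⟨t, ht, hcard⟩ := (hs.sdiff F.finite_toSet).exists_subset_card_eq (k - F.card)
  refine ⟨F ∪ t, Finset.subset_union_left, fun x hx => ?_, ?_⟩
  · rcases Finset.mem_union.1 hx with h | h
    exacts [hF x h, (ht h).1]
  · rw [Finset.card_union_of_disjoint, hcard]
    · omega
    · exact Finset.disjoint_right.2 fun x hx hxF => (ht hx).2 hxF

/-- The rank-one case: for vectors `u` with positive entries, `u ^ m` is dominated by the powers
`u ^ α e`, uniformly in `u`, when there are at least `N` exponents below `m` and either the entries
of `u` are bounded or there are at least `N` exponents above `m`. -/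
theorem exists_rankOne_bound {ι : Type*} [DecidableEq ι] (α : ι → ℝ)
    (hα : Function.Injective α) (m : ℝ) (E : Finset ι) (hm : ∀ e ∈ E, α e ≠ m) (N : ℕ)
    (U : Set ℝ) (hU : ∀ x ∈ U, 0 < x) (hlow : N ≤ (E.filter (α · < m)).card)
    (hhigh : BddAbove U ∨ N ≤ (E.filter (m < α ·)).card) (d : ι → ℝ) (hd : ∀ e ∈ E, 0 < d e) :
    ∃ t, 0 < t ∧ ∀ (u : Fin N → ℝ), (∀ i, u i ∈ U) → ∀ v : Fin N → ℝ,
      t * (∑ i, v i * u i ^ m) ^ 2 ≤ ∑ e ∈ E, d e * (∑ i, v i * u i ^ α e) ^ 2 := by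
  -- the threshold separating small from large points
  obtain ⟨r, hr⟩ : ∃ r : ℝ, (∀ x ∈ U, Real.log x ≤ r) ∨ N ≤ (E.filter (m < α ·)).card := by
    rcases hhigh with ⟨R, hR⟩ | h
    · exact ⟨Real.log R, Or.inl fun x hx => Real.log_le_log (hU x hx) (hR hx)⟩
    · exact ⟨0, Or.inr h⟩
  obtain ⟨C, hC, hint⟩ := exists_bounded_interpolation α hα m r E hm
  have hK : 0 < 1 + ∑ e ∈ E, C ^ 2 / d e :=
    add_pos_of_pos_of_nonneg one_pos
      (Finset.sum_nonneg fun e he => div_nonneg (sq_nonneg _) (hd e he).le)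
  refine ⟨(1 + ∑ e ∈ E, C ^ 2 / d e)⁻¹, inv_pos.2 hK, fun u hu v => ?_⟩
  have hcard : ((Finset.univ : Finset (Fin N)).image fun i => Real.log (u i)).card ≤ N :=
    Finset.card_image_le.trans (by simp)
  set Z := (Finset.univ : Finset (Fin N)).image fun i => Real.log (u i) with hZ
  obtain ⟨S, hZS, hS, hSc⟩ := exists_superset_card_eq_of_infinite (Set.Iic_infinite r)
    (Z.filter (· ≤ r)) (fun x hx => (Finset.mem_filter.1 hx).2) (E.filter (α · < m)).card
    ((Finset.card_filter_le _ _).trans (hcard.trans hlow))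
  obtain ⟨T, hZT, hT, hTc⟩ := exists_superset_card_eq_of_infinite (Set.Ioi_infinite r)
    (Z.filter (r < ·)) (fun x hx => (Finset.mem_filter.1 hx).2) (E.filter (m < α ·)).card (by
      rcases hr with h | h
      · rw [Finset.filter_eq_empty_iff.2]
        · simp
        · intro x hx
          obtain ⟨i, -, rfl⟩ := Finset.mem_image.1 hx
          exact not_lt.2 (h _ (hu i))
      · exact (Finset.card_filter_le _ _).trans (hcard.trans h))
  obtain ⟨a, haC, ha⟩ := hint S T hS hT hSc hTc
  have hrpow : ∀ i (β : ℝ), u i ^ β = Real.exp (β * Real.log (u i)) := fun i β => by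
    rw [Real.rpow_def_of_pos (hU _ (hu i)), mul_comm]
  have hui : ∀ i, u i ^ m = ∑ e ∈ E, a e * u i ^ α e := fun i => by
    have hmem : Real.log (u i) ∈ Z := Finset.mem_image.2 ⟨i, Finset.mem_univ _, rfl⟩
    simp only [hrpow]
    refine ha _ (Finset.mem_union.2 ?_)
    rcases le_or_gt (Real.log (u i)) r with h | h
    · exact Or.inl (hZS (Finset.mem_filter.2 ⟨hmem, h⟩))
    · exact Or.inr (hZT (Finset.mem_filter.2 ⟨hmem, h⟩))
  have hsum : ∑ i, v i * u i ^ m = ∑ e ∈ E, a e * ∑ i, v i * u i ^ α e := by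
    simp only [hui, Finset.mul_sum]
    rw [Finset.sum_comm]
    exact Finset.sum_congr rfl fun e _ => Finset.sum_congr rfl fun i _ => by ring
  set X : ι → ℝ := fun e => ∑ i, v i * u i ^ α e with hX
  -- Cauchy-Schwarz with weights `d`
  have hcs : (∑ e ∈ E, a e * X e) ^ 2 ≤ (∑ e ∈ E, a e ^ 2 / d e) * ∑ e ∈ E, d e * X e ^ 2 :=
    Finset.sum_sq_le_sum_mul_sum_of_sq_le_mul E
      (fun e he => div_nonneg (sq_nonneg _) (hd e he).le)
      (fun e he => mul_nonneg (hd e he).le (sq_nonneg _))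
      fun e he => by
        have := hd e he
        refine le_of_eq ?_
        field_simp
  have hX0 : 0 ≤ ∑ e ∈ E, d e * X e ^ 2 :=
    Finset.sum_nonneg fun e he => mul_nonneg (hd e he).le (sq_nonneg _)
  have ha2 : ∑ e ∈ E, a e ^ 2 / d e ≤ 1 + ∑ e ∈ E, C ^ 2 / d e := by
    have : ∑ e ∈ E, a e ^ 2 / d e ≤ ∑ e ∈ E, C ^ 2 / d e := Finset.sum_le_sum fun e he => by
      have h1 : a e ^ 2 ≤ C ^ 2 := sq_le_sq.2 ((haC e he).trans (le_abs_self C))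
      exact div_le_div_of_nonneg_right h1 (hd e he).le
    linarith
  rw [hsum, inv_mul_le_iff₀ hK]
  exact hcs.trans (mul_le_mul_of_nonneg_right ha2 hX0)

/-! ### From rank one to all ranks -/

/-- Positive semidefiniteness of a real matrix in terms of its quadratic form. -/
lemma posSemidef_iff_sum_nonneg {k : ℕ} (A : Matrix (Fin k) (Fin k) ℝ) :
    A.PosSemidef ↔ (∀ i j, A j i = A i j) ∧ ∀ v : Fin k → ℝ, 0 ≤ ∑ i, ∑ j, v i * v j * A i j := by
  have h : ∀ v : Fin k → ℝ, dotProduct (star v) (A.mulVec v) = ∑ i, ∑ j, v i * v j * A i j :=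
    fun v => by
      simp only [dotProduct, Matrix.mulVec, Finset.mul_sum, Pi.star_apply, star_trivial]
      exact Finset.sum_congr rfl fun i _ => Finset.sum_congr rfl fun j _ => by ring
  rw [Matrix.posSemidef_iff_dotProduct_mulVec, Matrix.IsHermitian.ext_iff]
  simp only [h]
  simp only [star_trivial]

lemma sum_sum_mul_rankOne {k : ℕ} (v w : Fin k → ℝ) :
    ∑ i, ∑ j, v i * v j * (w i * w j) = (∑ i, v i * w i) ^ 2 := by
  rw [sq, Finset.sum_mul_sum]
  exact Finset.sum_congr rfl fun i _ => Finset.sum_congr rfl fun j _ => by ring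

/-- Subtracting from a positive semidefinite matrix the rank-one matrix with the same first row
leaves a positive semidefinite matrix. -/
lemma posSemidef_sub_rankOne {k : ℕ} {A : Matrix (Fin (k + 1)) (Fin (k + 1)) ℝ}
    (hA : A.PosSemidef) (h0 : 0 < A 0 0) :
    (Matrix.of fun i j => A i j - A i 0 * A j 0 / A 0 0).PosSemidef := by
  rw [posSemidef_iff_sum_nonneg] at hA ⊢
  refine ⟨fun i j => by simp [hA.1 i j, mul_comm], fun v => ?_⟩
  -- test `A` on the component of `v` that is `A`-orthogonal to the first basis vector
  set c : ℝ := (∑ i, v i * A i 0) / A 0 0 with hc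
  have hcA : ∑ i, v i * A i 0 = c * A 0 0 := by rw [hc]; field_simp
  have hcA' : ∑ i, v i * A 0 i = c * A 0 0 := by simp only [← hcA, hA.1 0]
  have h1 := hA.2 (fun i => v i - if i = 0 then c else 0)
  have h2 : ∑ i, ∑ j, (v i - if i = 0 then c else 0) * (v j - if j = 0 then c else 0) * A i j =
      ∑ i, ∑ j, v i * v j * A i j - c ^ 2 * A 0 0 := by
    have hin : ∀ i, ∑ j, (v i - if i = 0 then c else 0) * (v j - if j = 0 then c else 0) * A i j =
        (v i - if i = 0 then c else 0) * (∑ j, v j * A i j - c * A i 0) := fun i => by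
      rw [mul_sub, Finset.mul_sum]
      simp only [mul_sub, sub_mul, Finset.sum_sub_distrib, mul_ite, ite_mul, mul_zero, zero_mul,
        Finset.sum_ite_eq', Finset.mem_univ, if_true]
      simp only [mul_assoc]
    have hsplit : ∀ f : Fin (k + 1) → ℝ,
        ∑ i, (v i - if i = 0 then c else 0) * f i = ∑ i, v i * f i - c * f 0 := fun f => by
      simp [sub_mul, Finset.sum_sub_distrib]
    simp only [hin]
    rw [hsplit, hcA']
    have : ∑ i, v i * (∑ j, v j * A i j - c * A i 0) =
        ∑ i, ∑ j, v i * v j * A i j - c * (c * A 0 0) := by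
      rw [← hcA, Finset.mul_sum, ← Finset.sum_sub_distrib]
      refine Finset.sum_congr rfl fun i _ => ?_
      rw [mul_sub, Finset.mul_sum]
      congr 1
      · exact Finset.sum_congr rfl fun j _ => by ring
      · ring
    rw [this]
    ring
  rw [h2] at h1
  have h3 : ∑ i, ∑ j, v i * v j * (A i 0 * A j 0 / A 0 0) = c ^ 2 * A 0 0 := by
    have : ∑ i, ∑ j, v i * v j * (A i 0 * A j 0 / A 0 0) =
        (∑ i, ∑ j, v i * v j * (A i 0 * A j 0)) / A 0 0 := by
      simp only [Finset.sum_div, mul_div_assoc]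
    rw [this, sum_sum_mul_rankOne, hcA]
    field_simp
  simp only [Matrix.of_apply, mul_sub, Finset.sum_sub_distrib]
  rw [h3]
  exact h1

/-- If `f` maps the rank-one positive semidefinite matrices of size `k + 1` to positive semidefinite
matrices, and `f'` preserves positivity in size `k`, then `f` preserves positivity in size `k + 1`.
Subtracting from `A` the rank-one matrix `R` with the same first row, the quadratic form of
`f (R + t • (A - R))` is monotone in `t`, by the Schur product theorem. -/
theorem isEntrywisePositivityPreserver_succ {k : ℕ} {I : Set ℝ}
    (hI : ∀ x ∈ I, 0 < x ∧ ∀ y, 0 < y → y ≤ x → y ∈ I) {f f' : ℝ → ℝ}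
    (hf : ∀ x, 0 < x → HasDerivAt f (f' x) x)
    (hrank : ∀ u : Fin (k + 1) → ℝ, (∀ i, 0 < u i) → (∀ i, u i ^ 2 ∈ I) →
      ∀ v : Fin (k + 1) → ℝ, 0 ≤ ∑ i, ∑ j, v i * v j * f (u i * u j))
    (hder : IsEntrywisePositivityPreserver k I f') :
    IsEntrywisePositivityPreserver (k + 1) I f := by
  intro A hA
  have hApos : ∀ i j, 0 < A i j := fun i j => (hI _ (hA.2 i j)).1
  have h0 := hApos 0 0
  set s := √(A 0 0) with hs
  have hs0 : 0 < s := Real.sqrt_pos.2 h0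
  have hss : s * s = A 0 0 := Real.mul_self_sqrt h0.le
  set u : Fin (k + 1) → ℝ := fun i => A i 0 / s with hu
  have hupos : ∀ i, 0 < u i := fun i => div_pos (hApos i 0) hs0
  have huu : ∀ i j, u i * u j = A i 0 * A j 0 / A 0 0 := fun i j => by
    rw [hu]
    simp only
    rw [div_mul_div_comm, hss]
  set B : Matrix (Fin (k + 1)) (Fin (k + 1)) ℝ := Matrix.of fun i j => A i j - u i * u j with hB
  have hBpsd : B.PosSemidef := by
    have := posSemidef_sub_rankOne hA.1 h0
    simp only [← huu] at this
    exact this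
  have hAsymm := ((posSemidef_iff_sum_nonneg A).1 hA.1).1
  have hB0 : ∀ i, B i 0 = 0 := fun i => by
    simp only [hB, Matrix.of_apply, huu]
    field_simp
    ring
  have hB0' : ∀ i, B 0 i = 0 := fun i => by
    rw [← ((posSemidef_iff_sum_nonneg B).1 hBpsd).1, hB0]
  have huI : ∀ i, u i ^ 2 ∈ I := fun i => by
    refine (hI _ (hA.2 i i)).2 _ (by have := hupos i; positivity) ?_
    have := hBpsd.diag_nonneg (i := i)
    simp only [hB, Matrix.of_apply] at this
    nlinarith
  have huuI : ∀ i j, u i * u j ∈ I := fun i j => by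
    have hij := mul_pos (hupos i) (hupos j)
    rcases le_total (u i) (u j) with h | h
    · exact (hI _ (huI j)).2 _ hij (by nlinarith [hupos i, hupos j])
    · exact (hI _ (huI i)).2 _ hij (by nlinarith [hupos i, hupos j])
  set M : ℝ → Matrix (Fin (k + 1)) (Fin (k + 1)) ℝ :=
    fun t => Matrix.of fun i j => u i * u j + t * B i j with hM
  have hMconv : ∀ t i j, M t i j = (1 - t) * (u i * u j) + t * A i j := fun t i j => by
    simp only [hM, hB, Matrix.of_apply]
    ring
  have hMpos : ∀ t ∈ Set.Icc (0 : ℝ) 1, ∀ i j, 0 < M t i j := fun t ht i j => by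
    rw [hMconv]
    have h1 := mul_pos (hupos i) (hupos j)
    have h2 := hApos i j
    rcases ht.1.eq_or_lt with h | h
    · simpa [← h] using h1
    · nlinarith [mul_nonneg (sub_nonneg.2 ht.2) h1.le, mul_pos h h2]
  have hMI : ∀ t ∈ Set.Icc (0 : ℝ) 1, ∀ i j, M t i j ∈ I := fun t ht i j => by
    have hle : M t i j ≤ max (u i * u j) (A i j) := by
      rw [hMconv]
      nlinarith [mul_le_mul_of_nonneg_left (le_max_left (u i * u j) (A i j)) (sub_nonneg.2 ht.2),
        mul_le_mul_of_nonneg_left (le_max_right (u i * u j) (A i j)) ht.1]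
    rcases le_max_iff.1 hle with h | h
    · exact (hI _ (huuI i j)).2 _ (hMpos t ht i j) h
    · exact (hI _ (hA.2 i j)).2 _ (hMpos t ht i j) h
  have hRpsd : (Matrix.of fun i j => u i * u j).PosSemidef := by
    rw [posSemidef_iff_sum_nonneg]
    refine ⟨fun i j => mul_comm _ _, fun v => ?_⟩
    simp only [Matrix.of_apply, sum_sum_mul_rankOne]
    positivity
  have hMpsd : ∀ t ∈ Set.Icc (0 : ℝ) 1, (M t).PosSemidef := fun t ht => by
    have := hRpsd.add (hBpsd.smul ht.1)
    exact this
  rw [posSemidef_iff_sum_nonneg]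
  refine ⟨fun i j => by simp [hAsymm i j], fun v => ?_⟩
  set φ : ℝ → ℝ := fun t => ∑ i, ∑ j, v i * v j * f (M t i j) with hφ
  set φ' : ℝ → ℝ := fun t => ∑ i, ∑ j, v i * v j * (f' (M t i j) * B i j) with hφ'
  have hderiv : ∀ t ∈ Set.Icc (0 : ℝ) 1, HasDerivAt φ (φ' t) t := fun t ht => by
    refine HasDerivAt.fun_sum fun i _ => HasDerivAt.fun_sum fun j _ => ?_
    refine ((hf _ (hMpos t ht i j)).comp t ?_).const_mul _
    simpa [hM] using ((hasDerivAt_id t).mul_const (B i j)).const_add (u i * u j)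
  have hnonneg : ∀ t ∈ Set.Icc (0 : ℝ) 1, 0 ≤ φ' t := fun t ht => by
    have h1 : ((M t).submatrix Fin.succ Fin.succ).map f' |>.PosSemidef :=
      hder _ ⟨(hMpsd t ht).submatrix _, fun i j => hMI t ht _ _⟩
    have h2 := ((posSemidef_iff_sum_nonneg _).1
      (h1.hadamard (hBpsd.submatrix Fin.succ))).2 fun i => v i.succ
    -- the first row and column of `B` vanish
    simp only [hφ', Fin.sum_univ_succ, hB0, hB0', mul_zero, zero_add, Finset.sum_const_zero]
    exact h2
  have hmono : MonotoneOn φ (Set.Icc 0 1) :=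
    monotoneOn_of_deriv_nonneg (convex_Icc 0 1)
      (fun t ht => (hderiv t ht).continuousAt.continuousWithinAt)
      (fun t ht => (hderiv t (interior_subset ht)).differentiableAt.differentiableWithinAt)
      fun t ht => by
        rw [(hderiv t (interior_subset ht)).deriv]
        exact hnonneg t (interior_subset ht)
  have hle := hmono (Set.left_mem_Icc.2 zero_le_one) (Set.right_mem_Icc.2 zero_le_one) zero_le_one
  have hφ0 : 0 ≤ φ 0 := by simpa [hφ, hM] using hrank u hupos huI v
  have hφ1 : φ 1 = ∑ i, ∑ j, v i * v j * A.map f i j := by simp [hφ, hMconv]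
  exact hφ1 ▸ hφ0.trans hle

lemma isEntrywisePositivityPreserver_zero (I : Set ℝ) (f : ℝ → ℝ) :
    IsEntrywisePositivityPreserver 0 I f := fun A _ =>
  (posSemidef_iff_sum_nonneg _).2 ⟨fun i => i.elim0, fun v => by simp⟩

lemma IsEntrywisePositivityPreserver.add {k : ℕ} {I : Set ℝ} {f g : ℝ → ℝ}
    (hf : IsEntrywisePositivityPreserver k I f) (hg : IsEntrywisePositivityPreserver k I g) :
    IsEntrywisePositivityPreserver k I fun x => f x + g x :=
  fun A hA => (hf A hA).add (hg A hA)

lemma IsEntrywisePositivityPreserver.const_mul {k : ℕ} {I : Set ℝ} {f : ℝ → ℝ}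
    (hf : IsEntrywisePositivityPreserver k I f) {c : ℝ} (hc : 0 ≤ c) :
    IsEntrywisePositivityPreserver k I fun x => c * f x :=
  fun A hA => (hf A hA).smul hc

lemma sum_sum_mul_rpow_mul {k : ℕ} {u : Fin k → ℝ} (hu : ∀ i, 0 < u i) (v : Fin k → ℝ) (β : ℝ) :
    ∑ i, ∑ j, v i * v j * (u i * u j) ^ β = (∑ i, v i * u i ^ β) ^ 2 := by
  rw [← sum_sum_mul_rankOne]
  exact Finset.sum_congr rfl fun i _ => Finset.sum_congr rfl fun j _ => by
    rw [Real.mul_rpow (hu i).le (hu j).le]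

/-! ### Power functions -/

/-- The condition `β ∈ ℤ≥0 ∪ [k - 1, ∞)`, under which `x ^ β` preserves positivity on matrices with
positive entries of size `k + 1`. For `k = 0` it includes negative exponents. -/
def IsAdmissibleExponent (k : ℕ) (β : ℝ) : Prop :=
  (∃ l : ℕ, β = l) ∨ (k : ℝ) - 1 ≤ β

lemma IsAdmissibleExponent.nonneg {k : ℕ} {β : ℝ} (h : IsAdmissibleExponent (k + 1) β) :
    0 ≤ β := by
  rcases h with ⟨l, rfl⟩ | h
  · positivity
  · push_cast at h
    have : (0 : ℝ) ≤ k := k.cast_nonneg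
    linarith

lemma IsAdmissibleExponent.sub_one {k : ℕ} {β : ℝ} (h : IsAdmissibleExponent (k + 1) β)
    (h0 : β ≠ 0) : IsAdmissibleExponent k (β - 1) := by
  rcases h with ⟨l, rfl⟩ | h
  · have hl : l ≠ 0 := by exact_mod_cast h0
    exact Or.inl ⟨l - 1, by rw [Nat.cast_sub (Nat.one_le_iff_ne_zero.2 hl), Nat.cast_one]⟩
  · push_cast at h
    exact Or.inr (by linarith)

/-- The theorem of FitzGerald and Horn: entrywise powers with admissible exponents preserve
positivity. -/
theorem isEntrywisePositivityPreserver_rpow {k : ℕ} {I : Set ℝ}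
    (hI : ∀ x ∈ I, 0 < x ∧ ∀ y, 0 < y → y ≤ x → y ∈ I) {β : ℝ} (hβ : IsAdmissibleExponent k β) :
    IsEntrywisePositivityPreserver (k + 1) I fun x => x ^ β := by
  induction k generalizing β with
  | zero =>
    refine isEntrywisePositivityPreserver_succ hI
      (fun x hx => Real.hasDerivAt_rpow_const (Or.inl hx.ne')) (fun u hu _ v => ?_)
      (isEntrywisePositivityPreserver_zero _ _)
    rw [sum_sum_mul_rpow_mul hu]
    positivity
  | succ k ih =>
    refine isEntrywisePositivityPreserver_succ hI
      (fun x hx => Real.hasDerivAt_rpow_const (Or.inl hx.ne')) (fun u hu _ v => ?_) ?_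
    · rw [sum_sum_mul_rpow_mul hu]
      positivity
    · by_cases h0 : β = 0
      · intro A _
        convert Matrix.PosSemidef.zero using 1
        ext i j
        simp [h0]
      · exact (ih (hβ.sub_one h0)).const_mul hβ.nonneg

/-- The inequality of `exists_rankOne_bound` as nonnegativity of quadratic forms. -/
lemma exists_rankOne_form_nonneg {ι : Type*} [DecidableEq ι] {k : ℕ} {I : Set ℝ} (α : ι → ℝ)
    (hα : Function.Injective α) (m : ℝ) (E : Finset ι) (hm : ∀ e ∈ E, α e ≠ m)
    (hlow : k ≤ (E.filter (α · < m)).card)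
    (hhigh : BddAbove I ∨ k ≤ (E.filter (m < α ·)).card) (d : ι → ℝ) (hd : ∀ e ∈ E, 0 < d e) :
    ∃ t₁, 0 < t₁ ∧ ∀ t, t ≤ t₁ → ∀ u : Fin k → ℝ, (∀ i, 0 < u i) → (∀ i, u i ^ 2 ∈ I) →
      ∀ v : Fin k → ℝ,
        0 ≤ ∑ i, ∑ j, v i * v j * (∑ e ∈ E, d e * (u i * u j) ^ α e - t * (u i * u j) ^ m) := by
  have hUI : BddAbove I → BddAbove {x : ℝ | 0 < x ∧ x ^ 2 ∈ I} := fun ⟨R, hR⟩ =>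
    ⟨R + 1, fun x hx => by nlinarith [hR hx.2, sq_nonneg (x - 1)]⟩
  obtain ⟨t₁, ht₁, hrank⟩ := exists_rankOne_bound α hα m E hm k {x | 0 < x ∧ x ^ 2 ∈ I}
    (fun x hx => hx.1) hlow (hhigh.imp_left hUI) d hd
  refine ⟨t₁, ht₁, fun t ht u hu huI v => ?_⟩
  have h1 := hrank u (fun i => ⟨hu i, huI i⟩) v
  have h2 : ∑ i, ∑ j, v i * v j * (∑ e ∈ E, d e * (u i * u j) ^ α e - t * (u i * u j) ^ m) =
      ∑ e ∈ E, d e * (∑ i, v i * u i ^ α e) ^ 2 - t * (∑ i, v i * u i ^ m) ^ 2 := by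
    simp only [← sum_sum_mul_rpow_mul hu, mul_sub, Finset.sum_sub_distrib, Finset.mul_sum]
    congr 1
    · simp only [Finset.sum_comm (t := E)]
      refine Finset.sum_congr rfl fun e _ => Finset.sum_congr rfl fun i _ =>
        Finset.sum_congr rfl fun j _ => by ring
    · exact Finset.sum_congr rfl fun i _ => Finset.sum_congr rfl fun j _ => by ring
  rw [h2]
  nlinarith [mul_le_mul_of_nonneg_right ht (sq_nonneg (∑ i, v i * u i ^ m))]

/-- A finite combination of admissible powers with positive coefficients stays a positivity
preserver after subtracting a small multiple of a further power, if there are enough exponents below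
it and either enough exponents above it or `I` is bounded. The induction on the size passes to
the derivative, which lowers the exponents by one and loses at most the exponent zero. -/
theorem exists_preserver_sum_sub {ι : Type*} [DecidableEq ι] {k : ℕ} {I : Set ℝ}
    (hI : ∀ x ∈ I, 0 < x ∧ ∀ y, 0 < y → y ≤ x → y ∈ I) (α : ι → ℝ) (hα : Function.Injective α)
    (m : ℝ) (E : Finset ι) (hm : ∀ e ∈ E, α e ≠ m) (hαk : ∀ e ∈ E, IsAdmissibleExponent k (α e))
    (hmk : IsAdmissibleExponent k m) (hlow : k + 1 ≤ (E.filter (α · < m)).card)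
    (hhigh : BddAbove I ∨ k + 1 ≤ (E.filter (m < α ·)).card) (d : ι → ℝ) (hd : ∀ e ∈ E, 0 < d e) :
    ∃ t, 0 < t ∧
      IsEntrywisePositivityPreserver (k + 1) I fun x => ∑ e ∈ E, d e * x ^ α e - t * x ^ m := by
  have hderiv : ∀ (α d : ι → ℝ) (m t x : ℝ), 0 < x →
      HasDerivAt (fun x => ∑ e ∈ E, d e * x ^ α e - t * x ^ m)
        (∑ e ∈ E, d e * (α e * x ^ (α e - 1)) - t * (m * x ^ (m - 1))) x := fun α d m t x hx =>
    (HasDerivAt.fun_sum fun e _ =>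
      (Real.hasDerivAt_rpow_const (Or.inl hx.ne')).const_mul (d e)).sub
      ((Real.hasDerivAt_rpow_const (Or.inl hx.ne')).const_mul t)
  obtain ⟨t₁, ht₁, hrank⟩ := exists_rankOne_form_nonneg α hα m E hm hlow hhigh d hd
  cases k with
  | zero =>
    exact ⟨t₁, ht₁, isEntrywisePositivityPreserver_succ hI (hderiv α d m t₁) (hrank t₁ le_rfl)
      (isEntrywisePositivityPreserver_zero _ _)⟩
  | succ k =>
    have hm0 : 0 < m := by
      obtain ⟨e, he⟩ := Finset.card_pos.1 (Nat.succ_pos _ |>.trans_le hlow)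
      rw [Finset.mem_filter] at he
      exact (hαk e he.1).nonneg.trans_lt he.2
    have hsub : ∀ e ∈ E.filter (α · ≠ 0), e ∈ E ∧ α e ≠ 0 := fun e he => Finset.mem_filter.1 he
    obtain ⟨t₂, ht₂, hpres⟩ := exists_preserver_sum_sub (k := k) hI (fun e => α e - 1)
      (fun a b h => hα (sub_left_injective h)) (m - 1) (E.filter (α · ≠ 0))
      (fun e he h => hm e (hsub e he).1 (sub_left_injective h))
      (fun e he => (hαk e (hsub e he).1).sub_one (hsub e he).2) (hmk.sub_one hm0.ne')
      (by
        have h1 := Finset.card_filter_add_card_filter_not (s := E.filter (α · < m)) (α · ≠ 0)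
        have h2 : ((E.filter (α · < m)).filter (¬ α · ≠ 0)).card ≤ 1 :=
          Finset.card_le_one.2 fun a ha b hb => hα (by
            rw [not_not.1 (Finset.mem_filter.1 ha).2, not_not.1 (Finset.mem_filter.1 hb).2])
        simp only [sub_lt_sub_iff_right]
        rw [Finset.filter_comm]
        omega)
      (hhigh.imp_right fun h => by
        have : (E.filter (α · ≠ 0)).filter (m - 1 < α · - 1) = E.filter (m < α ·) := by
          rw [Finset.filter_filter]
          refine Finset.filter_congr fun e _ => ?_
          rw [sub_lt_sub_iff_right]
          exact ⟨fun h => h.2, fun h => ⟨(hm0.trans h).ne', h⟩⟩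
        rw [this]
        omega)
      (fun e => d e * α e)
      (fun e he => mul_pos (hd e (hsub e he).1)
        ((hαk e (hsub e he).1).nonneg.lt_of_ne' (hsub e he).2))
    refine ⟨min t₁ (t₂ / m), lt_min ht₁ (div_pos ht₂ hm0),
      isEntrywisePositivityPreserver_succ hI (hderiv α d m _) (hrank _ (min_le_left _ _)) ?_⟩
    have hc : 0 ≤ t₂ - min t₁ (t₂ / m) * m := by
      have := mul_le_mul_of_nonneg_right (min_le_right t₁ (t₂ / m)) hm0.le
      rw [div_mul_cancel₀ _ hm0.ne'] at this
      linarith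
    convert hpres.add
      ((isEntrywisePositivityPreserver_rpow hI (hmk.sub_one hm0.ne')).const_mul hc) using 2 with x
    rw [Finset.sum_filter_of_ne]
    · simp only [mul_assoc]
      ring
    · intro e _ h h0
      exact h (by simp [h0])
termination_by k

/-! ### Infinite series -/

/-- Coefficients small enough for every power series with exponents `n i ≥ 0` to converge on
`(0, ∞)`. -/
noncomputable def smallCoeff (n : ℕ → ℝ) (i : ℕ) : ℝ :=
  (1 / 2) ^ i * (((i : ℝ) + 1) ^ n i)⁻¹

lemma smallCoeff_pos (n : ℕ → ℝ) (i : ℕ) : 0 < smallCoeff n i := by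
  unfold smallCoeff
  positivity

lemma summable_of_abs_le_smallCoeff {n c : ℕ → ℝ} (hn : ∀ i, 0 ≤ n i)
    (hc : ∀ i, |c i| ≤ smallCoeff n i) {x : ℝ} (hx : 0 < x) :
    Summable fun i => c i * x ^ n i := by
  refine Summable.of_norm_bounded_eventually_nat (g := fun i => (1 / 2 : ℝ) ^ i)
    summable_geometric_two ?_
  filter_upwards [Filter.eventually_ge_atTop ⌈x⌉₊] with i hi
  have hxi : x ≤ (i : ℝ) + 1 := (Nat.ceil_le.1 hi).trans (by linarith)
  have hp : 0 < ((i : ℝ) + 1) ^ n i := by positivity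
  rw [Real.norm_eq_abs, abs_mul, abs_of_pos (Real.rpow_pos_of_pos hx _)]
  calc |c i| * x ^ n i ≤ smallCoeff n i * ((i : ℝ) + 1) ^ n i :=
        mul_le_mul (hc i) (Real.rpow_le_rpow hx.le hxi (hn i)) (Real.rpow_nonneg hx.le _)
          (smallCoeff_pos n i).le
    _ = (1 / 2) ^ i := by
        unfold smallCoeff
        field_simp

/-- Given enough positive coefficients around each negative one, coefficients with the prescribed
signs exist: every negative term with index `i` is dominated, with a factor `(1/2) ^ (i + 1)` to
spare, by the sum of all positive terms. -/
theorem exists_preserver_of_signs {k : ℕ} {I : Set ℝ}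
    (hI : ∀ x ∈ I, 0 < x ∧ ∀ y, 0 < y → y ≤ x → y ∈ I) (n : ℕ → ℝ) (hinj : Function.Injective n)
    (hn : ∀ i, 0 ≤ n i) (hadm : ∀ i, IsAdmissibleExponent k (n i)) (ε : ℕ → SignType)
    (hneg : ∀ i₀, ε i₀ = -1 → ∃ E : Finset ℕ, (∀ e ∈ E, ε e = 1) ∧
      k + 1 ≤ (E.filter (n · < n i₀)).card ∧
      (BddAbove I ∨ k + 1 ≤ (E.filter (n i₀ < n ·)).card)) :
    ∃ (c : ℕ → ℝ) (f : ℝ → ℝ), (∀ i, SignType.sign (c i) = ε i) ∧ IsRealPowerSum n c I f ∧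
      IsEntrywisePositivityPreserver (k + 1) I f := by
  set d := smallCoeff n
  have hd : ∀ i, 0 < d i := smallCoeff_pos n
  have hex : ∀ i, ∃ t, 0 < t ∧ (ε i = -1 → ∃ E : Finset ℕ, (∀ e ∈ E, ε e = 1) ∧
      IsEntrywisePositivityPreserver (k + 1) I fun x => ∑ e ∈ E, d e * x ^ n e - t * x ^ n i) := by
    intro i
    by_cases hi : ε i = -1
    · obtain ⟨E, hE, hlow, hhigh⟩ := hneg i hi
      obtain ⟨t, ht, hpres⟩ := exists_preserver_sum_sub hI n hinj (n i) E
        (fun e he h => by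
          have h1 := hE e he
          rw [hinj h, hi] at h1
          exact absurd h1 (by decide))
        (fun e _ => hadm e) (hadm i) hlow hhigh d fun e _ => hd e
      exact ⟨t, ht, fun _ => ⟨E, hE, hpres⟩⟩
    · exact ⟨1, one_pos, fun h => absurd h hi⟩
  choose t ht htE using hex
  set c : ℕ → ℝ := fun i =>
    if ε i = 1 then d i else if ε i = -1 then -min (d i) ((1 / 2) ^ (i + 1) * t i) else 0 with hc
  have hmin : ∀ i, 0 < min (d i) ((1 / 2) ^ (i + 1) * t i) := fun i =>
    lt_min (hd i) (mul_pos (by positivity) (ht i))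
  have hcd : ∀ i, |c i| ≤ d i := fun i => by
    simp only [hc]
    split_ifs
    · exact (abs_of_pos (hd i)).le
    · rw [abs_neg, abs_of_pos (hmin i)]
      exact min_le_left _ _
    · simpa using (hd i).le
  have hsum : IsRealPowerSum n c I fun x => ∑' i, c i * x ^ n i := fun x hx =>
    (summable_of_abs_le_smallCoeff hn hcd (hI x hx).1).hasSum
  refine ⟨c, fun x => ∑' i, c i * x ^ n i, fun i => ?_, hsum, fun A hA => ?_⟩
  · simp only [hc]
    rcases h : ε i with _ | _ | _
    · simp
    · simpa using sign_neg (neg_neg_of_pos (hmin i))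
    · simpa using sign_pos (hd i)
  have hAsymm := ((posSemidef_iff_sum_nonneg A).1 hA.1).1
  rw [posSemidef_iff_sum_nonneg]
  refine ⟨fun i j => by simp [hAsymm i j], fun v => ?_⟩
  -- the quadratic forms of the entrywise powers of `A`
  set g : ℕ → ℝ := fun i => ∑ a, ∑ b, v a * v b * A a b ^ n i with hg
  have hg0 : ∀ i, 0 ≤ g i := fun i =>
    ((posSemidef_iff_sum_nonneg _).1
      (isEntrywisePositivityPreserver_rpow hI (hadm i) A hA)).2 v
  have hgsum : ∀ c' : ℕ → ℝ, (∀ a b, HasSum (fun i => c' i * A a b ^ n i)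
      (∑' i, c' i * A a b ^ n i)) →
      HasSum (fun i => c' i * g i) (∑ a, ∑ b, v a * v b * ∑' i, c' i * A a b ^ n i) :=
    fun c' hc' => by
      have := hasSum_sum (s := Finset.univ) fun a _ => hasSum_sum (s := Finset.univ) fun b _ =>
        (hc' a b).mul_left (v a * v b)
      refine this.congr_fun fun i => ?_
      simp only [hg, Finset.mul_sum]
      exact Finset.sum_congr rfl fun a _ => Finset.sum_congr rfl fun b _ => by ring
  have hcg := hgsum c fun a b => hsum _ (hA.2 a b)
  -- `P` is the sum of the quadratic forms of all positive terms
  set p : ℕ → ℝ := fun i => if ε i = 1 then d i else 0 with hp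
  have hpg := hgsum p fun a b => (summable_of_abs_le_smallCoeff hn (fun i => by
    simp only [hp]
    split_ifs
    · exact (abs_of_pos (hd i)).le
    · simpa using (hd i).le) (hI _ (hA.2 a b)).1).hasSum
  set P := ∑ a, ∑ b, v a * v b * ∑' i, p i * A a b ^ n i
  have hp0 : ∀ i, 0 ≤ p i * g i := fun i => mul_nonneg (by
    simp only [hp]
    split_ifs
    exacts [(hd i).le, le_rfl]) (hg0 i)
  have hP0 : 0 ≤ P := hpg.nonneg hp0
  have htg : ∀ i, ε i = -1 → t i * g i ≤ P := fun i hi => by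
    obtain ⟨E, hE, hpres⟩ := htE i hi
    have h1 := ((posSemidef_iff_sum_nonneg _).1 (hpres A hA)).2 v
    have h2 : ∑ a, ∑ b, v a * v b * A.map (fun x => ∑ e ∈ E, d e * x ^ n e - t i * x ^ n i) a b =
        ∑ e ∈ E, d e * g e - t i * g i := by
      simp only [hg, Matrix.map_apply, mul_sub, Finset.sum_sub_distrib, Finset.mul_sum]
      congr 1
      · simp only [Finset.sum_comm (t := E)]
        exact Finset.sum_congr rfl fun e _ => Finset.sum_congr rfl fun i _ =>
          Finset.sum_congr rfl fun j _ => by ring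
      · exact Finset.sum_congr rfl fun a _ => Finset.sum_congr rfl fun b _ => by ring
    have h3 : ∑ e ∈ E, d e * g e = ∑ e ∈ E, p e * g e :=
      Finset.sum_congr rfl fun e he => by simp [hp, hE e he]
    have h4 := sum_le_hasSum E (fun e _ => hp0 e) hpg
    linarith
  have hgeom : HasSum (fun i : ℕ => (1 / 2 : ℝ) ^ (i + 1) * P) P := by
    have := (hasSum_geometric_two.mul_left (1 / 2 : ℝ)).mul_right P
    simpa [pow_succ'] using this
  have hdiff := hpg.sub hgeom
  rw [sub_self] at hdiff
  refine hasSum_le (fun i => ?_) hdiff hcg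
  have hPi : 0 ≤ (1 / 2 : ℝ) ^ (i + 1) * P := by positivity
  by_cases h1 : ε i = 1
  · simp only [hc, hp, h1, if_true]
    linarith
  · by_cases h2 : ε i = -1
    · simp only [hc, hp, h2, if_true]
      have h3 := mul_le_mul_of_nonneg_right (min_le_right (d i) ((1 / 2) ^ (i + 1) * t i)) (hg0 i)
      have h4 := mul_le_mul_of_nonneg_left (htg i h2) (by positivity : (0 : ℝ) ≤ (1 / 2) ^ (i + 1))
      simp only [show ((-1 : SignType) = 1) = False by decide, if_false]
      linarith
    · simp only [hc, hp, h1, h2, if_false]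
      linarith

lemma exists_finset_of_le_encard {s : Set ℕ} {N : ℕ} (h : (N : ℕ∞) ≤ s.encard) :
    ∃ E : Finset ℕ, (∀ e ∈ E, e ∈ s) ∧ E.card = N := by
  obtain ⟨t, hts, ht⟩ := Set.exists_subset_encard_eq h
  have hfin : t.Finite := Set.finite_of_encard_eq_coe ht
  refine ⟨hfin.toFinset, fun e he => hts (hfin.mem_toFinset.1 he), ?_⟩
  rw [hfin.encard_eq_coe_toFinset_card] at ht
  exact_mod_cast ht

theorem mainTheorem8 (N : ℕ) (hN : 2 ≤ N) (n : ℕ → ℝ) (hn_inj : Function.Injective n)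
    (hn : ∀ i, (∃ k : ℕ, n i = (k : ℝ)) ∨ (N : ℝ) - 2 ≤ n i) (ε : ℕ → SignType) :
    ((∀ i₀, ε i₀ = -1 → (N : ℕ∞) ≤ {i | ε i = 1 ∧ n i < n i₀}.encard) →
      ∀ ρ : ℝ, 0 < ρ →
        ∃ (c : ℕ → ℝ) (f : ℝ → ℝ),
          (∀ i, SignType.sign (c i) = ε i) ∧
          IsRealPowerSum n c (Set.Ioo 0 ρ) f ∧
          IsEntrywisePositivityPreserver N (Set.Ioo 0 ρ) f) ∧
    ((∀ i₀, ε i₀ = -1 →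
        (N : ℕ∞) ≤ {i | ε i = 1 ∧ n i < n i₀}.encard ∧
        (N : ℕ∞) ≤ {i | ε i = 1 ∧ n i₀ < n i}.encard) →
      ∃ (c : ℕ → ℝ) (f : ℝ → ℝ),
        (∀ i, SignType.sign (c i) = ε i) ∧
        IsRealPowerSum n c (Set.Ioi 0) f ∧
        IsEntrywisePositivityPreserver N (Set.Ioi 0) f) := by
  obtain ⟨k, rfl⟩ : ∃ k, N = k + 1 + 1 := ⟨N - 2, by omega⟩
  have hadm : ∀ i, IsAdmissibleExponent (k + 1) (n i) := fun i =>
    (hn i).imp_right fun h => by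
      push_cast at h ⊢
      linarith
  have hn0 : ∀ i, 0 ≤ n i := fun i => (hadm i).nonneg
  constructor
  · intro h ρ _
    refine exists_preserver_of_signs (I := Set.Ioo 0 ρ)
      (fun x hx => ⟨hx.1, fun y hy hyx => ⟨hy, hyx.trans_lt hx.2⟩⟩) n hn_inj hn0 hadm ε
      fun i₀ hi₀ => ?_
    obtain ⟨E, hE, hcard⟩ := exists_finset_of_le_encard (h i₀ hi₀)
    refine ⟨E, fun e he => (hE e he).1, ?_, Or.inl bddAbove_Ioo⟩
    rw [Finset.filter_true_of_mem fun e he => (hE e he).2, hcard]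
  · intro h
    refine exists_preserver_of_signs (I := Set.Ioi 0) (fun x hx => ⟨hx, fun y hy _ => hy⟩)
      n hn_inj hn0 hadm ε fun i₀ hi₀ => ?_
    obtain ⟨E, hE, hcard⟩ := exists_finset_of_le_encard (h i₀ hi₀).1
    obtain ⟨F, hF, hcard'⟩ := exists_finset_of_le_encard (h i₀ hi₀).2
    refine ⟨E ∪ F, fun e he => ?_, ?_, Or.inr ?_⟩
    · rcases Finset.mem_union.1 he with he | he
      exacts [(hE e he).1, (hF e he).1]
    · rw [← hcard]
      exact Finset.card_le_card fun e he =>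
        Finset.mem_filter.2 ⟨Finset.mem_union_left _ he, (hE e he).2⟩
    · rw [← hcard']
      exact Finset.card_le_card fun e he =>
        Finset.mem_filter.2 ⟨Finset.mem_union_right _ he, (hF e he).2⟩
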